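/- Let $V$ be a finite-dimensional real vector space with a direct sum decomposition $V = V_1 \oplus \cdots \oplus V_r$ into subspaces. Let $(A_1,B_1),\dots,(A_m,B_m)$ be pairs of subspaces of $V$ that form a skew Bollobás system, that is, $\dim(A_i\cap B_i)=0$ for all $1\le i\le m$, and $\dim(A_i\cap B_j)>0$ for all $1\le i<j\le m$. Suppose that for every $1\le i\le m$ $$A_i=\bigoplus_{k=1}^r (A_i\cap V_k)\quad\text{and}\quad B_i=\bigoplus_{k=1}^r (B_i\cap V_k),$$ and put $a_{i,k}=\dim(A_i\cap V_k)$ and $b_{i,k}=\dim(B_i\cap V_k)$ for $1\le k\le r$. Then $$\sum_{i=1}^{m}\left[\prod_{k=1}^{r}\binom{a_{i,k}+b_{i,k}}{a_{i,k}}\,(1+a_{i,k}+b_{i,k})\right]^{-1}\le 1.$$ -/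

import Mathlib

/-- An ordered family of pairs `(A i, B i)`, `i : Fin m`, of subspaces of a real vector space is a
skew Bollobás system if `dim (A i ∩ B i) = 0` for all `i`, and `dim (A i ∩ B j) > 0` for all
`i < j`. -/
structure IsSkewBollobasSystem {V : Type*} [AddCommGroup V] [Module ℝ V] {m : ℕ}
    (A B : Fin m → Submodule ℝ V) : Prop where
  finrank_inf_eq_zero : ∀ i, Module.finrank ℝ ↥(A i ⊓ B i) = 0
  finrank_inf_pos : ∀ i j, i < j → 0 < Module.finrank ℝ ↥(A i ⊓ B j)

/-- The subspace `W` is the (internal) direct sum of the family of subspaces `U`. -/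
def IsDirectSumOf {V : Type*} [AddCommGroup V] [Module ℝ V] {r : ℕ}
    (W : Submodule ℝ V) (U : Fin r → Submodule ℝ V) : Prop :=
  iSupIndep U ∧ W = ⨆ k, U k

/-! The weight of a pair is a product over `k` of beta integrals. If `A_k + B_k` is not all of
`V_k`, pick `v` outside it and replace the pair by two: `v` joins `A_k` in the first, `B_k` in the
second. The total weight is unchanged, and the skew condition survives because `v` makes the first
new pair meet the second. Iterating, all pairs become complementary in every part.

With `d_k = dim V_k`, a complementary pair with `dim A_k = n_k` weighs `∏ 1 / (C(d_k, n_k) (1 +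
d_k))`, and exterior powers allow at most `∏ C(d_k, n_k)` such pairs. So each vector `n` contributes
at most `∏ 1 / (1 + d_k)`, and there are `∏ (1 + d_k)` vectors. -/

open Module

/-- The weight `1 / ((1 + a + b) * (a + b).choose a)`, which is the beta integral
`∫ x in 0..1, x ^ a * (1 - x) ^ b`. -/
noncomputable def betaWeight (a b : ℕ) : ℝ :=
  (((a + b).choose a : ℝ) * (1 + (a : ℝ) + (b : ℝ)))⁻¹

theorem betaWeight_nonneg (a b : ℕ) : 0 ≤ betaWeight a b := by
  unfold betaWeight; positivity

/-- Under the beta integral this is `1 = x + (1 - x)`. -/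
theorem betaWeight_eq_add (a b : ℕ) :
    betaWeight a b = betaWeight (a + 1) b + betaWeight a (b + 1) := by
  have hc : (0 : ℝ) < ((a + b).choose a : ℝ) := by
    exact_mod_cast Nat.choose_pos (Nat.le_add_right a b)
  have h1 : ((a + 1 + b).choose (a + 1) : ℝ) = (a + b + 1) * (a + b).choose a / (a + 1) := by
    rw [eq_div_iff (by positivity)]
    have := Nat.add_one_mul_choose_eq (a + b) a
    rw [show a + 1 + b = a + b + 1 by ring]
    exact_mod_cast this.symm
  have h2 : ((a + (b + 1)).choose a : ℝ) = (a + b + 1) * (a + b).choose a / (b + 1) := by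
    rw [eq_div_iff (by positivity)]
    have := Nat.add_one_mul_choose_eq (a + b) b
    rw [← Nat.choose_symm_add, add_assoc, ← Nat.choose_symm_add] at this
    exact_mod_cast this.symm
  unfold betaWeight
  rw [h1, h2]
  push_cast
  field_simp
  ring

/-! ### Families of subspaces, one per part -/

section Families

variable {K κ : Type*} [Field K] [Fintype κ] {V : κ → Type*} [∀ k, AddCommGroup (V k)]
  [∀ k, Module K (V k)]

/-- The product over all parts of the weights of the dimensions of a pair of families of
subspaces. -/
noncomputable def pairWeight
    (p : (∀ k, Submodule K (V k)) × (∀ k, Submodule K (V k))) : ℝ :=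
  ∏ k, betaWeight (finrank K (p.1 k)) (finrank K (p.2 k))

/-- The first family of `p` meets the second family of `q` nontrivially in some part. -/
def PairMeets (p q : (∀ k, Submodule K (V k)) × (∀ k, Submodule K (V k))) : Prop :=
  ∃ k, ¬ Disjoint (p.1 k) (q.2 k)

omit [Fintype κ] in
theorem PairMeets.mono {p q p' q' : (∀ k, Submodule K (V k)) × (∀ k, Submodule K (V k))}
    (h : PairMeets p q) (hp : p ≤ p') (hq : q ≤ q') : PairMeets p' q' := by
  obtain ⟨k, hk⟩ := h
  exact ⟨k, fun hd => hk (hd.mono (hp.1 k) (hq.2 k))⟩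

theorem finrank_sup_span_singleton_of_notMem {W : Type*} [AddCommGroup W] [Module K W]
    [FiniteDimensional K W] {S : Submodule K W} {v : W} (hv : v ∉ S) :
    finrank K ↥(S ⊔ Submodule.span K {v}) = finrank K S + 1 := by
  have hv0 : v ≠ 0 := fun h => hv (h ▸ S.zero_mem)
  have hd : Disjoint S (Submodule.span K {v}) :=
    (Submodule.disjoint_span_singleton' hv0).2 hv
  have := Submodule.finrank_sup_add_finrank_inf_eq S (Submodule.span K {v})
  rw [hd.eq_bot, finrank_bot, finrank_span_singleton hv0] at this
  exact this

theorem exists_complementary_extension [∀ k, FiniteDimensional K (V k)]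
    (p : (∀ k, Submodule K (V k)) × (∀ k, Submodule K (V k)))
    (hp : ∀ k, Disjoint (p.1 k) (p.2 k)) :
    ∃ L : List ((∀ k, Submodule K (V k)) × (∀ k, Submodule K (V k))),
      (∀ q ∈ L, p ≤ q ∧ ∀ k, IsCompl (q.1 k) (q.2 k)) ∧ L.Pairwise PairMeets ∧
        (L.map pairWeight).sum = pairWeight p := by
  classical
  -- Enlarging a pair must stop: finite dimension gives the ascending chain condition.
  have : WellFoundedGT ((∀ k, Submodule K (V k)) × (∀ k, Submodule K (V k))) :=
    inferInstanceAs (WellFoundedLT ((∀ k, (Submodule K (V k))ᵒᵈ) × (∀ k, (Submodule K (V k))ᵒᵈ)))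
  induction p using WellFoundedGT.induction with
  | ind p ih =>
  by_cases hc : ∀ k, IsCompl (p.1 k) (p.2 k)
  · exact ⟨[p], by simpa using hc, by simp, by simp⟩
  push Not at hc
  obtain ⟨k, hk⟩ := hc
  have hne : p.1 k ⊔ p.2 k ≠ ⊤ := fun h => hk ⟨hp k, codisjoint_iff.2 h⟩
  obtain ⟨v, -, hv⟩ := SetLike.exists_of_lt hne.lt_top
  have hv1 : v ∉ p.1 k := fun h => hv (Submodule.mem_sup_left h)
  have hv2 : v ∉ p.2 k := fun h => hv (Submodule.mem_sup_right h)
  have hv0 : v ≠ 0 := fun h => hv (h ▸ Submodule.zero_mem _)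
  have hd : Disjoint (p.1 k ⊔ p.2 k) (Submodule.span K {v}) :=
    (Submodule.disjoint_span_singleton' hv0).2 hv
  let p₁ : (∀ k, Submodule K (V k)) × (∀ k, Submodule K (V k)) :=
    (Function.update p.1 k (p.1 k ⊔ Submodule.span K {v}), p.2)
  let p₂ : (∀ k, Submodule K (V k)) × (∀ k, Submodule K (V k)) :=
    (p.1, Function.update p.2 k (p.2 k ⊔ Submodule.span K {v}))
  have hmem : v ∈ Submodule.span K {v} := Submodule.mem_span_singleton_self v
  have hlt₁ : p < p₁ := by
    refine Prod.mk_lt_mk_of_lt_of_le (lt_update_self_iff.2 ?_) le_rfl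
    exact left_lt_sup.2 fun h => hv1 (h hmem)
  have hlt₂ : p < p₂ := by
    refine Prod.mk_lt_mk_of_le_of_lt le_rfl (lt_update_self_iff.2 ?_)
    exact left_lt_sup.2 fun h => hv2 (h hmem)
  have hd₁ : ∀ j, Disjoint (p₁.1 j) (p₁.2 j) := by
    intro j
    by_cases hj : j = k
    · subst hj
      simp only [p₁, Function.update_self]
      exact ((hp j).symm.disjoint_sup_right_of_disjoint_sup_left (by rwa [sup_comm])).symm
    · simpa [p₁, Function.update_of_ne hj] using hp j
  have hd₂ : ∀ j, Disjoint (p₂.1 j) (p₂.2 j) := by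
    intro j
    by_cases hj : j = k
    · subst hj
      simp only [p₂, Function.update_self]
      exact (hp j).disjoint_sup_right_of_disjoint_sup_left hd
    · simpa [p₂, Function.update_of_ne hj] using hp j
  obtain ⟨L₁, hL₁, hR₁, hs₁⟩ := ih p₁ hlt₁ hd₁
  obtain ⟨L₂, hL₂, hR₂, hs₂⟩ := ih p₂ hlt₂ hd₂
  have hmeet : PairMeets p₁ p₂ := by
    refine ⟨k, fun h => hv0 ?_⟩
    refine Submodule.disjoint_def.1 h v ?_ ?_ <;>
    simp only [p₁, p₂, Function.update_self] <;>
    exact Submodule.mem_sup_right hmem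
  refine ⟨L₁ ++ L₂, ?_, ?_, ?_⟩
  · intro q hq
    rcases List.mem_append.1 hq with hq | hq
    · exact ⟨hlt₁.le.trans (hL₁ q hq).1, (hL₁ q hq).2⟩
    · exact ⟨hlt₂.le.trans (hL₂ q hq).1, (hL₂ q hq).2⟩
  · exact List.pairwise_append.2
      ⟨hR₁, hR₂, fun x hx y hy => hmeet.mono (hL₁ x hx).1 (hL₂ y hy).1⟩
  · rw [List.map_append, List.sum_append, hs₁, hs₂]
    unfold pairWeight
    -- Only the factor at `k` changes, so the beta recurrence applies there.
    rw [← Finset.mul_prod_erase _ _ (Finset.mem_univ k),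
      ← Finset.mul_prod_erase _ _ (Finset.mem_univ k),
      ← Finset.mul_prod_erase Finset.univ
        (fun k => betaWeight (finrank K (p.1 k)) (finrank K (p.2 k))) (Finset.mem_univ k)]
    have e₁ : ∏ j ∈ Finset.univ.erase k, betaWeight (finrank K (p₁.1 j)) (finrank K (p₁.2 j)) =
        ∏ j ∈ Finset.univ.erase k, betaWeight (finrank K (p.1 j)) (finrank K (p.2 j)) :=
      Finset.prod_congr rfl fun j hj => by
        rw [show p₁.1 j = p.1 j from Function.update_of_ne (Finset.ne_of_mem_erase hj) _ _]
    have e₂ : ∏ j ∈ Finset.univ.erase k, betaWeight (finrank K (p₂.1 j)) (finrank K (p₂.2 j)) =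
        ∏ j ∈ Finset.univ.erase k, betaWeight (finrank K (p.1 j)) (finrank K (p.2 j)) :=
      Finset.prod_congr rfl fun j hj => by
        rw [show p₂.2 j = p.2 j from Function.update_of_ne (Finset.ne_of_mem_erase hj) _ _]
    rw [e₁, e₂, ← add_mul]
    congr 1
    rw [show p₁.1 k = p.1 k ⊔ Submodule.span K {v} by simp [p₁],
      show p₂.2 k = p.2 k ⊔ Submodule.span K {v} by simp [p₂],
      finrank_sup_span_singleton_of_notMem hv1, finrank_sup_span_singleton_of_notMem hv2]
    exact (betaWeight_eq_add _ _).symm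

/-- The determinant pairing of a subspace `A` of dimension `n` with a subspace `B` of
codimension `n` factors through the exterior power and detects whether they are disjoint. -/
theorem exists_exteriorPower_pairing {W ι : Type*} [AddCommGroup W] [Module K W]
    [FiniteDimensional K W] (n : ℕ) (A B : ι → Submodule K W)
    (hA : ∀ i, finrank K (A i) = n) (hB : ∀ i, finrank K (W ⧸ B i) = n) :
    ∃ (w : ι → ⋀[K]^n W) (f : ι → ⋀[K]^n W →ₗ[K] K),
      ∀ i j, f j (w i) ≠ 0 ↔ Disjoint (A i) (B j) := by
  let e (i : ι) : Basis (Fin n) K (A i) := finBasisOfFinrankEq K (A i) (hA i)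
  let d (i : ι) : Basis (Fin n) K (W ⧸ B i) := finBasisOfFinrankEq K (W ⧸ B i) (hB i)
  refine ⟨fun i => exteriorPower.ιMulti K n fun x => (e i x : W),
    fun j => exteriorPower.alternatingMapLinearEquiv ((d j).det.compLinearMap (B j).mkQ),
    fun i j => ?_⟩
  rw [exteriorPower.alternatingMapLinearEquiv_apply_ιMulti, AlternatingMap.compLinearMap_apply]
  -- The determinant tests injectivity of this map, whose kernel is `A i ∩ B j`.
  let φ : A i →ₗ[K] W ⧸ B j := (B j).mkQ.domRestrict (A i)
  have hdet : (d j).det (φ ∘ e i) ≠ 0 ↔ LinearIndependent K (φ ∘ e i) := by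
    rw [← isUnit_iff_ne_zero, ← Basis.is_basis_iff_det, and_iff_left_iff_imp]
    exact fun h => h.span_eq_top_of_card_eq_finrank' (by simp [hB])
  have hker : LinearIndependent K (φ ∘ e i) ↔ LinearMap.ker φ = ⊥ := by
    refine ⟨fun h => ?_, fun h => (e i).linearIndependent.map' φ h⟩
    rw [LinearMap.ker_eq_bot']
    intro x hx
    rw [← (e i).sum_repr x, map_sum] at hx
    simp only [map_smul] at hx
    have hz := Fintype.linearIndependent_iff.1 h _ hx
    rw [← (e i).sum_repr x]
    exact Finset.sum_eq_zero fun y _ => by rw [hz y, zero_smul]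
  refine (hdet.trans hker).trans ?_
  rw [LinearMap.ker_eq_bot', Submodule.disjoint_def]
  constructor
  · intro h x hxA hxB
    exact congrArg Subtype.val (h ⟨x, hxA⟩ ((Submodule.Quotient.mk_eq_zero (B j)).2 hxB))
  · intro h x hx
    exact Subtype.ext (h x x.2 ((Submodule.Quotient.mk_eq_zero (B j)).1 hx))

/-- Multipart form of the skew Bollobás theorem for subspaces of fixed dimensions. -/
theorem card_le_prod_choose [∀ k, FiniteDimensional K (V k)] {ι : Type*} [Fintype ι]
    [LinearOrder ι] (p : ι → (∀ k, Submodule K (V k)) × (∀ k, Submodule K (V k)))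
    (hc : ∀ i k, IsCompl ((p i).1 k) ((p i).2 k)) (hp : ∀ i j, i < j → PairMeets (p i) (p j))
    (n : κ → ℕ) (hn : ∀ i k, finrank K ((p i).1 k) = n k) :
    Fintype.card ι ≤ ∏ k, (finrank K (V k)).choose (n k) := by
  classical
  have hB : ∀ i k, finrank K (V k ⧸ (p i).2 k) = n k := fun i k => by
    rw [← hn i k]
    exact (Submodule.quotientEquivOfIsCompl _ _ (hc i k).symm).finrank_eq
  choose w f hwf using fun k => exists_exteriorPower_pairing (n k) (fun i => (p i).1 k)
    (fun i => (p i).2 k) (fun i => hn i k) (fun i => hB i k)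
  let β (k : κ) : Basis (Fin ((finrank K (V k)).choose (n k))) K (⋀[K]^(n k) (V k)) :=
    finBasisOfFinrankEq K _ (exteriorPower.finrank_eq K (n k))
  -- Coordinates in the tensor product of the exterior powers: the matrix of pairings factors
  -- through a space of dimension `∏ C(d_k, n_k)`, yet is triangular with nonzero diagonal.
  let P : Matrix ι (∀ k, Fin ((finrank K (V k)).choose (n k))) K :=
    Matrix.of fun i s => ∏ k, (β k).repr (w k i) (s k)
  let Q : Matrix (∀ k, Fin ((finrank K (V k)).choose (n k))) ι K :=
    Matrix.of fun s j => ∏ k, f k j (β k (s k))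
  have hPQ : ∀ i j, (P * Q) i j = ∏ k, f k j (w k i) := by
    intro i j
    have h : ∀ k, f k j (w k i) = ∑ s, (β k).repr (w k i) s * f k j (β k s) := fun k => by
      conv_lhs => rw [← (β k).sum_repr (w k i)]
      rw [map_sum]
      simp only [map_smul, smul_eq_mul]
    simp_rw [h, Finset.prod_univ_sum, Matrix.mul_apply, P, Q, Matrix.of_apply,
      Finset.prod_mul_distrib, Fintype.piFinset_univ]
  have hlow : (P * Q).BlockTriangular OrderDual.toDual := by
    intro i j hij
    obtain ⟨k, hk⟩ := hp i j hij
    rw [hPQ]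
    exact Finset.prod_eq_zero (Finset.mem_univ k) (by_contra fun h => hk ((hwf k i j).1 h))
  have hdet : IsUnit (P * Q).det := by
    rw [Matrix.det_of_isLowerTriangular _ hlow, isUnit_iff_ne_zero]
    refine Finset.prod_ne_zero_iff.2 fun i _ => ?_
    rw [hPQ]
    exact Finset.prod_ne_zero_iff.2 fun k _ => (hwf k i i).2 (hc i k).disjoint
  have hrank := Matrix.rank_of_isUnit (P * Q) ((Matrix.isUnit_iff_isUnit_det _).2 hdet)
  rw [← hrank]
  refine (Matrix.rank_mul_le_left P Q).trans ((Matrix.rank_le_card_width P).trans ?_)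
  simp

theorem sum_pairWeight_le_one_of_isCompl [∀ k, FiniteDimensional K (V k)] {ι : Type*} [Fintype ι]
    [LinearOrder ι] (p : ι → (∀ k, Submodule K (V k)) × (∀ k, Submodule K (V k)))
    (hc : ∀ i k, IsCompl ((p i).1 k) ((p i).2 k)) (hp : ∀ i j, i < j → PairMeets (p i) (p j)) :
    ∑ i, pairWeight (p i) ≤ 1 := by
  classical
  let T : Finset (κ → ℕ) := Fintype.piFinset fun k => Finset.range (finrank K (V k) + 1)
  have hT : ∀ i ∈ Finset.univ, (fun k => finrank K ((p i).1 k)) ∈ T := fun i _ => by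
    simp only [T, Fintype.mem_piFinset, Finset.mem_range]
    exact fun k => Nat.lt_succ_of_le (Submodule.finrank_le _)
  rw [← Finset.sum_fiberwise_of_maps_to hT]
  calc _ ≤ ∑ n ∈ T, ∏ k, ((1 : ℝ) + finrank K (V k))⁻¹ := Finset.sum_le_sum fun n hn => ?_
    _ = 1 := by
      rw [← Finset.prod_univ_sum (fun k => Finset.range (finrank K (V k) + 1))
        (fun k _ => ((1 : ℝ) + finrank K (V k))⁻¹)]
      refine Finset.prod_eq_one fun k _ => ?_
      rw [Finset.sum_const, Finset.card_range, nsmul_eq_mul]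
      push_cast
      rw [add_comm]
      exact mul_inv_cancel₀ (by positivity)
  simp only [T, Fintype.mem_piFinset, Finset.mem_range] at hn
  set s := Finset.univ.filter fun i => (fun k => finrank K ((p i).1 k)) = n with hs
  have hsn : ∀ i ∈ s, ∀ k, finrank K ((p i).1 k) = n k := fun i hi k =>
    congrFun (Finset.mem_filter.1 hi).2 k
  have hw : ∀ i ∈ s, pairWeight (p i) =
      ∏ k, (((finrank K (V k)).choose (n k) : ℝ) * (1 + finrank K (V k)))⁻¹ := by
    intro i hi
    refine Finset.prod_congr rfl fun k _ => ?_
    have h := Submodule.finrank_add_eq_of_isCompl (hc i k)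
    rw [betaWeight, h, hsn i hi k, add_assoc, ← h, hsn i hi k]
    push_cast
    rfl
  have hcard : (s.card : ℝ) ≤ ∏ k, ((finrank K (V k)).choose (n k) : ℝ) := by
    have := card_le_prod_choose (fun i : s => p i) (fun i => hc i) (fun i j hij => hp i j hij) n
      (fun i => hsn i i.2)
    rw [Fintype.card_coe] at this
    exact_mod_cast this
  rw [Finset.sum_congr rfl hw, Finset.sum_const, nsmul_eq_mul]
  refine (mul_le_mul_of_nonneg_right hcard (Finset.prod_nonneg fun k _ => by positivity)).trans ?_
  rw [← Finset.prod_mul_distrib]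
  refine (Finset.prod_congr rfl fun k _ => ?_).le
  have : (0 : ℝ) < (finrank K (V k)).choose (n k) := by
    exact_mod_cast Nat.choose_pos (Nat.lt_succ_iff.1 (hn k))
  field_simp

/-- Concatenating the complementary extensions in order keeps the skew condition, since meeting is
monotone. -/
theorem sum_pairWeight_le_one [∀ k, FiniteDimensional K (V k)]
    (L : List ((∀ k, Submodule K (V k)) × (∀ k, Submodule K (V k))))
    (hd : ∀ p ∈ L, ∀ k, Disjoint (p.1 k) (p.2 k)) (hL : L.Pairwise PairMeets) :
    (L.map pairWeight).sum ≤ 1 := by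
  have hex : ∀ p : (∀ k, Submodule K (V k)) × (∀ k, Submodule K (V k)),
      ∃ L : List ((∀ k, Submodule K (V k)) × (∀ k, Submodule K (V k))),
      (∀ k, Disjoint (p.1 k) (p.2 k)) → (∀ q ∈ L, p ≤ q ∧ ∀ k, IsCompl (q.1 k) (q.2 k)) ∧
        L.Pairwise PairMeets ∧ (L.map pairWeight).sum = pairWeight p := fun p => by
    by_cases h : ∀ k, Disjoint (p.1 k) (p.2 k)
    · obtain ⟨L, hL⟩ := exists_complementary_extension p h
      exact ⟨L, fun _ => hL⟩
    -- Junk value, never used.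
    · exact ⟨[], fun h' => absurd h' h⟩
  choose E hE using hex
  have hsum : ((L.flatMap E).map pairWeight).sum = (L.map pairWeight).sum := by
    rw [List.map_flatMap, List.flatMap_def, List.sum_flatten, List.map_map]
    exact congrArg List.sum (List.map_congr_left fun p hp => (hE p (hd p hp)).2.2)
  have hpair : (L.flatMap E).Pairwise PairMeets := by
    refine List.pairwise_flatMap.2 ⟨fun p hp => (hE p (hd p hp)).2.1, ?_⟩
    refine hL.imp_of_mem fun {p q} hp hq hpq x hx y hy => ?_
    exact hpq.mono ((hE p (hd p hp)).1 x hx).1 ((hE q (hd q hq)).1 y hy).1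
  have hcompl : ∀ q ∈ L.flatMap E, ∀ k, IsCompl (q.1 k) (q.2 k) := by
    intro q hq
    obtain ⟨p, hp, hqp⟩ := List.mem_flatMap.1 hq
    exact ((hE p (hd p hp)).1 q hqp).2
  rw [← hsum, ← Fin.sum_univ_fun_getElem]
  exact sum_pairWeight_le_one_of_isCompl (fun i : Fin (L.flatMap E).length => (L.flatMap E)[i])
    (fun i => hcompl _ (List.getElem_mem _))
    (fun i j hij => List.pairwise_iff_getElem.1 hpair _ _ _ _ hij)

end Families

/-- Lets a nonzero vector of `A_i ∩ B_j` be replaced by a nonzero component, so that the meeting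
happens inside a single part. -/
theorem decompose_mem_of_eq_iSup_inf {K V ι : Type*} [Semiring K] [AddCommMonoid V] [Module K V]
    [DecidableEq ι] {U : ι → Submodule K V} [DirectSum.Decomposition U] {S : Submodule K V}
    (hS : S = ⨆ k, S ⊓ U k) {x : V} (hx : x ∈ S) (k : ι) :
    (DirectSum.decompose U x k : V) ∈ S := by
  rw [hS] at hx
  induction hx using Submodule.iSup_induction' with
  | mem l y hy =>
    by_cases hkl : l = k
    · subst hkl
      rw [DirectSum.decompose_of_mem_same U hy.2]
      exact hy.1
    · rw [DirectSum.decompose_of_mem_ne U hy.2 hkl]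
      exact S.zero_mem
  | zero => simp
  | add y z _ _ hy hz =>
    rw [DirectSum.decompose_add]
    exact S.add_mem hy hz

theorem theorem1p3 {V : Type*} [AddCommGroup V] [Module ℝ V] [FiniteDimensional ℝ V]
    (r m : ℕ) (U : Fin r → Submodule ℝ V) (hU : DirectSum.IsInternal U)
    (A B : Fin m → Submodule ℝ V) (hAB : IsSkewBollobasSystem A B)
    (hA : ∀ i, IsDirectSumOf (A i) (fun k => A i ⊓ U k))
    (hB : ∀ i, IsDirectSumOf (B i) (fun k => B i ⊓ U k))
    (a b : Fin m → Fin r → ℕ)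
    (ha : ∀ i k, a i k = Module.finrank ℝ ↥(A i ⊓ U k))
    (hb : ∀ i k, b i k = Module.finrank ℝ ↥(B i ⊓ U k)) :
    ∑ i, (∏ k, (((a i k + b i k).choose (a i k) : ℝ) * (1 + (a i k : ℝ) + (b i k : ℝ))))⁻¹
      ≤ 1 := by
  have hfin : ∀ (S : Submodule ℝ V) k,
      finrank ℝ ↥(S.submoduleOf (U k)) = finrank ℝ ↥(S ⊓ U k) := fun S k => by
    rw [← Submodule.finrank_map_subtype_eq (U k) (S.submoduleOf (U k)), Submodule.submoduleOf,
      Submodule.map_comap_subtype, inf_comm]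
  let p (i : Fin m) : (∀ k, Submodule ℝ (U k)) × (∀ k, Submodule ℝ (U k)) :=
    (fun k => (A i).submoduleOf (U k), fun k => (B i).submoduleOf (U k))
  have hdis : ∀ i k, Disjoint ((p i).1 k) ((p i).2 k) := fun i k => by
    rw [Submodule.disjoint_def]
    intro x hx hy
    have h : (x : V) ∈ A i ⊓ B i := ⟨hx, hy⟩
    rw [Submodule.finrank_eq_zero.1 (hAB.finrank_inf_eq_zero i)] at h
    exact Subtype.ext ((Submodule.mem_bot ℝ).1 h)
  have hmeet : ∀ i j, i < j → PairMeets (p i) (p j) := by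
    intro i j hij
    by_contra h
    simp only [PairMeets, not_exists, not_not] at h
    refine (hAB.finrank_inf_pos i j hij).ne' (Submodule.finrank_eq_zero.2 ?_)
    let _ := hU.chooseDecomposition
    refine (Submodule.eq_bot_iff _).2 fun x hx => (DirectSum.decompose U).injective ?_
    rw [DirectSum.decompose_zero]
    refine DFinsupp.ext fun k => Submodule.disjoint_def.1 (h k) _ ?_ ?_
    · exact decompose_mem_of_eq_iSup_inf (hA i).2 hx.1 k
    · exact decompose_mem_of_eq_iSup_inf (hB j).2 hx.2 k
  have := sum_pairWeight_le_one (List.ofFn p) (by simpa [List.mem_ofFn] using hdis)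
    (List.pairwise_ofFn.2 hmeet)
  rw [List.map_ofFn, List.sum_ofFn] at this
  refine le_trans (Finset.sum_le_sum fun i _ => le_of_eq ?_) this
  simp only [Function.comp_apply, pairWeight, betaWeight, p, hfin, ← ha, ← hb,
    Finset.prod_inv_distrib]
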